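/- **Theorem.** Consider a linear convolutional network with $L$ layers, filter widths $k_1,\dots,k_L\ge 1$, all strides equal to one, and layer dimensions $d_0,\dots,d_L$ with $d_l=d_{l-1}-k_l+1$. A filter $w\in\mathbb{R}^{m}$ defines convolutional matrices $W$ by $(Wx)_i=\sum_{j=0}^{m-1}w_jx_{i+j}$, and the parameterization map $\mu$ sends $\theta=(w_1,\dots,w_L)\in\mathbb{R}^{k_1}\times\cdots\times\mathbb{R}^{k_L}$ to the product $W_L\cdots W_1\in\mathbb{R}^{d_L\times d_0}$ of the convolutional matrices $W_l\in\mathbb{R}^{d_l\times d_{l-1}}$ with filters $w_l$. This product is the convolutional matrix of a filter of width $k=1+\sum_{l=1}^L(k_l-1)$, and $d_L\times d_0$ convolutional matrices are identified with their filters in $\mathbb{R}^k$. Write $\pi(w)=w_0\mathsf{x}^{m-1}+w_1\mathsf{x}^{m-2}\mathsf{y}+\cdots+w_{m-1}\mathsf{y}^{m-1}$ for $w\in\mathbb{R}^m$. For a partition $\lambda=(\lambda_1,\dots,\lambda_r)$ of $k-1$ let $\Delta_\lambda\subset\mathbb{R}[\mathsf{x},\mathsf{y}]_{k-1}$ be the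 set of real binary forms that can be written as $c\,Q_1^{\lambda_1}\cdots Q_r^{\lambda_r}$ with $c\in\mathbb{C}$ and complex linear forms $Q_1,\dots,Q_r$ (not necessarily distinct). Let $\ell$ be a smooth real-valued function on $\mathbb{R}^{d_L\times d_0}$ and $\mathcal{L}=\ell\circ\mu$. Let $\overline w\in\mathbb{R}^k$ be a critical point of $\ell|_{\pi^{-1}(\Delta_\lambda)}$, that is, near $\overline w$ the set $\pi^{-1}(\Delta_\lambda)\subset\mathbb{R}^k$ is a smooth submanifold, and the differential of $\ell$ (as a function of the filter in $\mathbb{R}^k$) at $\overline w$ vanishes on the tangent space of $\pi^{-1}(\Delta_\lambda)$ at $\overline w$. If $\theta=(w_1,\dots,w_L)$ satisfies $\mu(\theta)=\overline w$ and none of the binary forms $\pi(w_1),\dots,\pi(w_L)$ has a repeated root in $\mathbb{P}^1(\mathbb{C})$ (the zero form counts as having repeated roots), then $\theta$ is a critical point of $\mathcal{L}$, that is, $d\mathcal{L}(\theta)=0$. -/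

import Mathlib

open scoped ContDiff

attribute [local instance] Matrix.normedAddCommGroup Matrix.normedSpace

namespace LCN

open MvPolynomial
open scoped Topology

/-- The convolutional (Toeplitz) matrix of stride one with filter `w` of width `k`: the matrix of
the map `x ↦ (i ↦ ∑ j, w j * x (i + j))`, for output size `m` and input size `n`. -/
def convMatrix {k : ℕ} (m n : ℕ) (w : Fin k → ℝ) : Matrix (Fin m) (Fin n) ℝ :=
  Matrix.of fun i c => ∑ j : Fin k, if (c : ℕ) = (i : ℕ) + (j : ℕ) then w j else 0

/-- The product `W_L ⋯ W_2 W_1` of a chain of matrices of compatible sizes. -/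
def chainProd {L : ℕ} (d : Fin (L + 1) → ℕ)
    (W : ∀ l : Fin L, Matrix (Fin (d l.succ)) (Fin (d l.castSucc)) ℝ) :
    Matrix (Fin (d (Fin.last L))) (Fin (d 0)) ℝ :=
  Fin.induction (motive := fun l => Matrix (Fin (d l)) (Fin (d 0)) ℝ)
    1 (fun l M => W l * M) (Fin.last L)

/-- The parameterization map `μ` of the linear convolutional network with layer dimensions `d`,
filter widths `k` and all strides equal to one: it sends the filters `θ = (w_1, …, w_L)` to the
product of their convolutional matrices. -/
def paramMap {L : ℕ} (d : Fin (L + 1) → ℕ) (k : Fin L → ℕ) (θ : ∀ l : Fin L, Fin (k l) → ℝ) :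
    Matrix (Fin (d (Fin.last L))) (Fin (d 0)) ℝ :=
  chainProd d fun l => convMatrix (d l.succ) (d l.castSucc) (θ l)

/-- The binary form `π(w) = w_0 x^(k-1) + w_1 x^(k-2) y + ⋯ + w_(k-1) y^(k-1)` of a filter `w`;
here `x = X 0` and `y = X 1`. -/
noncomputable def filterPoly {k : ℕ} (w : Fin k → ℝ) : MvPolynomial (Fin 2) ℝ :=
  ∑ i : Fin k, C (w i) * X 0 ^ (k - 1 - (i : ℕ)) * X 1 ^ (i : ℕ)

/-- The multiple root locus `Δ_Λ` of `Λ = (Λ_1, …, Λ_r)`: the real binary forms that factor as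
`Q_1 ^ Λ_1 ⋯ Q_r ^ Λ_r` with complex linear forms `Q_i`, up to a complex constant. If `r > 0` and
the `Λ_i` are positive, then the constant can be absorbed into the `Q_i`; for `r = 0` it makes
`Δ_Λ` the set of all forms of degree zero. -/
def multipleRootLocus {r : ℕ} (Λ : Fin r → ℕ) : Set (MvPolynomial (Fin 2) ℝ) :=
  {P | ∃ (c : ℂ) (Q : Fin r → MvPolynomial (Fin 2) ℂ), (∀ i, (Q i).IsHomogeneous 1) ∧
    map (algebraMap ℝ ℂ) P = C c * ∏ i, Q i ^ Λ i}

/-- A real binary form has a repeated root if, for some point `[a : b]` of the complex projective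
line, the square of the linear form `b x - a y` vanishing there divides it. The zero form has
repeated roots. -/
def HasRepeatedRoot (P : MvPolynomial (Fin 2) ℝ) : Prop :=
  ∃ a b : ℂ, (a ≠ 0 ∨ b ≠ 0) ∧ (C b * X 0 - C a * X 1) ^ 2 ∣ map (algebraMap ℝ ℂ) P

section Critical

variable {E : Type*} [NormedAddCommGroup E] [NormedSpace ℝ E]

/-- `p` is a smooth point of `S`: near `p`, the set `S` is a smooth submanifold, that is, the zero
set of a smooth map with surjective differential at `p`. -/
def IsSmoothPoint (S : Set E) (p : E) : Prop :=
  p ∈ S ∧ ∃ (n : ℕ) (F : E → Fin n → ℝ) (U : Set E), IsOpen U ∧ p ∈ U ∧ ContDiffOn ℝ ∞ F U ∧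
    Function.Surjective (fderiv ℝ F p) ∧ ∀ x ∈ U, x ∈ S ↔ F x = 0

/-- The tangent vectors of `S` at `p`: the velocities of the smooth curves in `S` through `p`. -/
def tangentVectors (S : Set E) (p : E) : Set E :=
  {v | ∃ γ : ℝ → E, ContDiffAt ℝ ∞ γ 0 ∧ γ 0 = p ∧ (∀ᶠ t in 𝓝 (0 : ℝ), γ t ∈ S) ∧
    HasDerivAt γ v 0}

/-- `p ∈ Crit(f|_S)`: the point `p` is a smooth point of `S` and the differential of `f` at `p`
vanishes on the tangent space of `S` at `p`. -/
def IsCriticalOn (f : E → ℝ) (S : Set E) (p : E) : Prop :=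
  IsSmoothPoint S p ∧ ∀ v ∈ tangentVectors S p, fderiv ℝ f p v = 0

end Critical

end LCN

namespace LCN

/-! Setting `x = 1` turns a binary form into a polynomial in `y`, with the drop in degree recording
the root at `x = 0`, called infinity below. Composing convolutions multiplies these polynomials. If
`P` comes from the end-to-end filter, `F` from layer `l` and `H` from the product of the other
layers, then `F * H = P`, and varying layer `l` in direction `u` moves `P` with velocity `u * H`.
The claim is that the differential kills all such `u * H`.

If `f` is an irreducible factor of `P` of exact multiplicity `m`, so that `P = f ^ m * g`, then all
complex roots of `f` have multiplicity `m` in `P`. The curve `(f + t u) ^ m * g` moves the parts of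
the partition sitting at each root together, so it stays in the locus. Its velocity at `t = 0` is
`m` times `u * P / f`, so that direction is killed (`InRootLocus.perturb_irreducible`,
`VanishesOnPencils.irreducible`). The root at infinity is handled likewise
(`InRootLocus.perturb_infinity`).

Since `F` has no repeated root, partial fractions write `u * H = (u / F) * P` as a sum of such
directions (`VanishesOnPencils.squarefree_form`). The chain rule concludes. -/

open Polynomial

/-! ### The root locus and the motion of its roots -/

/-- The dehomogenized multiple root locus: real polynomials that are, over `ℂ`, a constant times
`∏ i, q i ^ Λ i` with polynomials `q i` of degree at most one. -/
def InRootLocus {r : ℕ} (Λ : Fin r → ℕ) (P : ℝ[X]) : Prop :=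
  ∃ (c : ℂ) (q : Fin r → ℂ[X]), (∀ i, (q i).natDegree ≤ 1) ∧
    P.map (algebraMap ℝ ℂ) = C c * ∏ i, q i ^ Λ i

/-- The monic linear polynomial with root `z`, and `1` for the point at infinity. -/
noncomputable def pointFactor : Option ℂ → ℂ[X]
  | none => 1
  | some z => X - C z

lemma pointFactor_ne_zero (o : Option ℂ) : pointFactor o ≠ 0 := by
  cases o with
  | none => exact one_ne_zero
  | some z => exact X_sub_C_ne_zero z

lemma natDegree_pointFactor_le (o : Option ℂ) : (pointFactor o).natDegree ≤ 1 := by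
  cases o <;> simp [pointFactor]

lemma exists_eq_C_mul_pointFactor {q : ℂ[X]} (hq : q.natDegree ≤ 1) :
    ∃ a o, q = C a * pointFactor o := by
  obtain ⟨a, b, rfl⟩ := exists_eq_X_add_C_of_natDegree_le_one hq
  by_cases ha : a = 0
  · exact ⟨b, none, by simp [pointFactor, ha]⟩
  · refine ⟨a, some (-b / a), ?_⟩
    have : C b = C a * C (b / a) := by rw [← C_mul, mul_div_cancel₀ _ ha]
    rw [this]
    simp only [pointFactor, neg_div, C_neg]
    ring

/-- Scaling each linear factor collects all scalars in `c`, so only a placement `ρ` of the parts at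
points of the projective line remains. -/
lemma InRootLocus.exists_points {r : ℕ} {Λ : Fin r → ℕ} {P : ℝ[X]} (hP : InRootLocus Λ P) :
    ∃ (c : ℂ) (ρ : Fin r → Option ℂ),
      P.map (algebraMap ℝ ℂ) = C c * ∏ i, pointFactor (ρ i) ^ Λ i := by
  obtain ⟨c, q, hq, h⟩ := hP
  choose a ρ hρ using fun i => exists_eq_C_mul_pointFactor (hq i)
  refine ⟨c * ∏ i, a i ^ Λ i, ρ, ?_⟩
  rw [h]
  conv_lhs => enter [2, 2, i]; rw [hρ i, mul_pow]
  simp [Finset.prod_mul_distrib, mul_assoc, map_prod]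

/-- Replacing the factors at a set of points of equal multiplicity `m`. -/
lemma prod_replace_factors {r m : ℕ} {Λ : Fin r → ℕ} {ρ : Fin r → Option ℂ}
    (O : Finset (Option ℂ)) (hO : ∀ o ∈ O, ∑ i with ρ i = o, Λ i = m) (K : Option ℂ → ℂ[X]) :
    (∏ i, (if ρ i ∈ O then K (ρ i) else pointFactor (ρ i)) ^ Λ i) *
        (∏ o ∈ O, pointFactor o) ^ m =
      (∏ o ∈ O, K o) ^ m * ∏ i, pointFactor (ρ i) ^ Λ i := by
  -- Grouping the indices by their point, the exponents over each point of `O` add up to `m`.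
  have key (J : Option ℂ → ℂ[X]) :
      ∏ i with ρ i ∈ O, J (ρ i) ^ Λ i = (∏ o ∈ O, J o) ^ m := by
    rw [← Finset.prod_fiberwise_of_maps_to (t := O) (g := ρ) (by simp), ← Finset.prod_pow]
    refine Finset.prod_congr rfl fun o ho => ?_
    rw [← hO o ho, ← Finset.prod_pow_eq_pow_sum, Finset.filter_filter]
    refine Finset.prod_congr ?_ ?_
    · ext i
      simp only [Finset.mem_filter, Finset.mem_univ, true_and]
      exact ⟨fun h => h.2, fun h => ⟨h ▸ ho, h⟩⟩
    · intro i hi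
      rw [(Finset.mem_filter.1 hi).2]
  rw [← Finset.prod_filter_mul_prod_filter_not Finset.univ (fun i => ρ i ∈ O),
    ← Finset.prod_filter_mul_prod_filter_not Finset.univ (fun i => ρ i ∈ O)
      (f := fun i => pointFactor (ρ i) ^ Λ i), key, ← key K]
  have h1 : ∏ i with ρ i ∈ O, (if ρ i ∈ O then K (ρ i) else pointFactor (ρ i)) ^ Λ i =
      ∏ i with ρ i ∈ O, K (ρ i) ^ Λ i :=
    Finset.prod_congr rfl fun i hi => by rw [if_pos (Finset.mem_filter.1 hi).2]
  have h2 : ∏ i with ρ i ∉ O, (if ρ i ∈ O then K (ρ i) else pointFactor (ρ i)) ^ Λ i =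
      ∏ i with ρ i ∉ O, pointFactor (ρ i) ^ Λ i :=
    Finset.prod_congr rfl fun i hi => by rw [if_neg (Finset.mem_filter.1 hi).2]
  rw [h1, h2]
  ring

lemma count_roots_prod_pointFactor {r : ℕ} (Λ : Fin r → ℕ) (ρ : Fin r → Option ℂ) {c : ℂ}
    (hc : c ≠ 0) (z : ℂ) :
    (C c * ∏ i, pointFactor (ρ i) ^ Λ i).roots.count z = ∑ i with ρ i = some z, Λ i := by
  have hne : ∏ i, pointFactor (ρ i) ^ Λ i ≠ 0 :=
    Finset.prod_ne_zero_iff.2 fun i _ => pow_ne_zero _ (pointFactor_ne_zero _)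
  rw [roots_C_mul _ hc, roots_prod _ _ hne, Multiset.count_bind, Finset.sum_filter]
  refine Finset.sum_congr rfl fun i _ => ?_
  rw [roots_pow, Multiset.count_nsmul]
  cases h : ρ i with
  | none => simp [pointFactor]
  | some y =>
    by_cases hy : y = z
    · simp [pointFactor, hy]
    · simp [pointFactor, hy, Ne.symm hy]

/-- Parts placed at infinity contribute no degree, so the degree deficit is the multiplicity of
infinity. -/
lemma natDegree_prod_pointFactor {r : ℕ} (Λ : Fin r → ℕ) (ρ : Fin r → Option ℂ) {c : ℂ}
    (hc : c ≠ 0) :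
    (C c * ∏ i, pointFactor (ρ i) ^ Λ i).natDegree + ∑ i with ρ i = none, Λ i = ∑ i, Λ i := by
  rw [natDegree_C_mul hc, natDegree_prod _ _ fun i _ => pow_ne_zero _ (pointFactor_ne_zero _),
    Finset.sum_filter, ← Finset.sum_add_distrib]
  refine Finset.sum_congr rfl fun i _ => ?_
  rw [natDegree_pow]
  cases h : ρ i <;> simp [pointFactor]

/-- Serves to attach the factors of `f + u` to the roots of `f`. Constant factors are allowed
because the degree may drop, with roots escaping to infinity. -/
lemma exists_eq_prod_natDegree_le_one {ι : Type*} [DecidableEq ι] (s : Finset ι) (p : ℂ[X])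
    (hp : p.natDegree ≤ s.card) :
    ∃ (c : ℂ) (l : ι → ℂ[X]), (∀ i, (l i).natDegree ≤ 1) ∧ p = C c * ∏ i ∈ s, l i := by
  induction s using Finset.induction_on generalizing p with
  | empty =>
    obtain ⟨c, rfl⟩ := natDegree_eq_zero.1 (Nat.le_zero.1 hp)
    exact ⟨c, fun _ => 1, by simp⟩
  | insert a s ha ih =>
    rw [Finset.card_insert_of_notMem ha] at hp
    obtain ⟨q, y, hq, hy, rfl⟩ : ∃ q y : ℂ[X], q.natDegree ≤ s.card ∧ y.natDegree ≤ 1 ∧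
        p = y * q := by
      by_cases h0 : p.natDegree = 0
      · exact ⟨p, 1, by simp [h0]⟩
      · obtain ⟨z, hz⟩ := IsAlgClosed.exists_root p
          fun h => h0 (natDegree_eq_of_degree_eq_some h)
        obtain ⟨q, rfl⟩ := dvd_iff_isRoot.2 hz
        refine ⟨q, X - C z, ?_, by simp, rfl⟩
        have hq0 : q ≠ 0 := by rintro rfl; simp at h0
        rw [natDegree_mul (X_sub_C_ne_zero z) hq0, natDegree_X_sub_C] at hp
        omega
    obtain ⟨c, l, hl, rfl⟩ := ih q hq
    refine ⟨c, Function.update l a y, fun i => ?_, ?_⟩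
    · by_cases h : i = a
      · subst h; simpa using hy
      · simpa [Function.update_of_ne h] using hl i
    · rw [Finset.prod_insert ha, Function.update_self, Finset.prod_congr rfl fun i hi =>
        Function.update_of_ne (ne_of_mem_of_not_mem hi ha) y l]
      ring

/-- Moving the roots of an irreducible factor `f` of exact multiplicity `m` stays in the locus. -/
lemma InRootLocus.perturb_irreducible {r m : ℕ} {Λ : Fin r → ℕ} {f g u : ℝ[X]}
    (hf : Irreducible f) (hfg : ¬ f ∣ g) (hP : InRootLocus Λ (f ^ m * g))
    (hu : u.natDegree ≤ f.natDegree) : InRootLocus Λ ((f + u) ^ m * g) := by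
  set φ := algebraMap ℝ ℂ
  obtain ⟨c, ρ, h⟩ := hP.exists_points
  have hF0 : f.map φ ≠ 0 := Polynomial.map_ne_zero hf.ne_zero
  have hG0 : g.map φ ≠ 0 := Polynomial.map_ne_zero fun h0 => hfg (h0 ▸ dvd_zero f)
  have hP0 : (f ^ m * g).map φ ≠ 0 := by
    rw [Polynomial.map_mul, Polynomial.map_pow]
    exact mul_ne_zero (pow_ne_zero _ hF0) hG0
  have hc : c ≠ 0 := by
    rintro rfl
    exact hP0 (by simpa using h)
  -- Over `ℂ`, `f` stays coprime to `g` and, being separable, has simple roots. Hence each root of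
  -- `f` has multiplicity exactly `m` in the product.
  have hcop : IsCoprime (f.map φ) (g.map φ) :=
    (hf.coprime_iff_not_dvd.2 hfg).map (mapRingHom φ)
  have hnodup : (f.map φ).roots.Nodup := nodup_roots (hf.separable.map)
  set Z := (f.map φ).roots.toFinset with hZ
  have hsplit : (f.map φ).Splits := IsAlgClosed.splits _
  have hFZ : f.map φ = C (f.map φ).leadingCoeff * ∏ z ∈ Z, (X - C z) := by
    conv_lhs => rw [hsplit.eq_prod_roots]
    rw [Finset.prod, hZ, Multiset.toFinset_val, hnodup.dedup]
  have hcard : Z.card = f.natDegree := by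
    rw [hZ, Multiset.toFinset_card_of_nodup hnodup, ← natDegree_map φ (p := f)]
    exact (splits_iff_card_roots.1 hsplit)
  let O : Finset (Option ℂ) := Z.map Function.Embedding.some
  have hO : ∀ o ∈ O, ∑ i with ρ i = o, Λ i = m := by
    intro o ho
    obtain ⟨z, hz, rfl⟩ := Finset.mem_map.1 ho
    have hzr : z ∈ (f.map φ).roots := Multiset.mem_toFinset.1 hz
    have hzG : z ∉ (g.map φ).roots := by
      intro hzg
      obtain ⟨a, b, hab⟩ := hcop
      have := congrArg (eval z) hab
      rw [eval_add, eval_mul, eval_mul, (mem_roots'.1 hzr).2, (mem_roots'.1 hzg).2] at this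
      simp at this
    change ∑ i with ρ i = some z, Λ i = m
    rw [← count_roots_prod_pointFactor Λ ρ hc z, ← h, Polynomial.map_mul,
      roots_mul (by rwa [← Polynomial.map_mul]), Multiset.count_add, Polynomial.map_pow, roots_pow,
      Multiset.count_nsmul, Multiset.count_eq_zero_of_notMem hzG,
      Multiset.count_eq_one_of_mem hnodup hzr]
    simp
  obtain ⟨b, l, hl, hb⟩ := exists_eq_prod_natDegree_le_one Z ((f + u).map φ) (by
    rw [hcard, natDegree_map]
    exact (natDegree_add_le _ _).trans (max_le le_rfl hu))
  let K : Option ℂ → ℂ[X] := fun o => o.elim 1 l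
  have hK : ∀ o, (K o).natDegree ≤ 1 := by
    rintro (_ | z)
    · simp [K]
    · exact hl z
  have hrep := prod_replace_factors O hO K
  have hOpf : ∏ o ∈ O, pointFactor o = ∏ z ∈ Z, (X - C z) := by
    simp [O, Finset.prod_map, pointFactor]
  have hOK : ∏ o ∈ O, K o = ∏ z ∈ Z, l z := by simp [O, Finset.prod_map, K]
  rw [hOpf, hOK] at hrep
  set a := (f.map φ).leadingCoeff
  have ha : a ≠ 0 := leadingCoeff_ne_zero.2 hF0
  have hA0 : ∏ z ∈ Z, (X - C z) ≠ 0 := Finset.prod_ne_zero_iff.2 fun z _ => X_sub_C_ne_zero z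
  -- `a` and `b` are the scalars in the linear factorizations of `f` and `f + u`; the new constant
  -- trades `a ^ m` for `b ^ m`.
  refine ⟨b ^ m * (a ^ m)⁻¹ * c, fun i => if ρ i ∈ O then K (ρ i) else pointFactor (ρ i),
    fun i => ?_, ?_⟩
  · dsimp only
    split_ifs
    exacts [hK _, natDegree_pointFactor_le _]
  · have haC : C (a ^ m)⁻¹ * C a ^ m = 1 := by
      rw [← C_pow, ← C_mul, inv_mul_cancel₀ (pow_ne_zero _ ha), C_1]
    refine mul_right_cancel₀ (pow_ne_zero m hA0) ?_
    rw [mul_assoc _ _ ((∏ z ∈ Z, (X - C z)) ^ m), hrep, Polynomial.map_mul, Polynomial.map_pow,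
      hb]
    rw [Polynomial.map_mul, Polynomial.map_pow, hFZ] at h
    have h' : C (a ^ m)⁻¹ * C c * ∏ i, pointFactor (ρ i) ^ Λ i =
        (∏ z ∈ Z, (X - C z)) ^ m * g.map φ := by
      rw [mul_assoc, ← h]
      linear_combination ((∏ z ∈ Z, (X - C z)) ^ m * g.map φ) * haC
    simp only [C_mul, C_pow]
    linear_combination (-C b ^ m * (∏ z ∈ Z, l z) ^ m) * h'

/-- Moving the root at infinity, of exact multiplicity `m`, stays in the locus. -/
lemma InRootLocus.perturb_infinity {r m : ℕ} {Λ : Fin r → ℕ} {P u : ℝ[X]}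
    (hP0 : P ≠ 0) (hP : InRootLocus Λ P) (hm : P.natDegree + m = ∑ i, Λ i)
    (hu : u.natDegree ≤ 1) : InRootLocus Λ ((1 + u) ^ m * P) := by
  obtain ⟨c, ρ, h⟩ := hP.exists_points
  have hc : c ≠ 0 := by
    rintro rfl
    exact Polynomial.map_ne_zero (f := algebraMap ℝ ℂ) hP0 (by simpa using h)
  have hO : ∀ o ∈ ({none} : Finset (Option ℂ)), ∑ i with ρ i = o, Λ i = m := by
    intro o ho
    rw [Finset.mem_singleton.1 ho]
    have := natDegree_prod_pointFactor Λ ρ hc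
    rw [← h, natDegree_map] at this
    omega
  set v := (1 + u).map (algebraMap ℝ ℂ) with hv
  have hvd : v.natDegree ≤ 1 := by
    rw [hv, natDegree_map]
    exact (natDegree_add_le _ _).trans (max_le (by simp) hu)
  -- All parts at infinity, where the factor is `1`, receive the factor `1 + u` at once.
  have hrep := prod_replace_factors {none} hO fun _ => v
  refine ⟨c, fun i => if ρ i ∈ ({none} : Finset (Option ℂ)) then v else pointFactor (ρ i),
    fun i => ?_, ?_⟩
  · dsimp only
    split_ifs
    exacts [hvd, natDegree_pointFactor_le _]
  · rw [Polynomial.map_mul, Polynomial.map_pow, ← hv, h]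
    simp only [Finset.prod_singleton] at hrep
    rw [show pointFactor none = 1 from rfl, one_pow, mul_one] at hrep
    rw [hrep]
    ring

lemma InRootLocus.C_mul {r : ℕ} {Λ : Fin r → ℕ} {P : ℝ[X]} (hP : InRootLocus Λ P) (a : ℝ) :
    InRootLocus Λ (C a * P) := by
  obtain ⟨c, q, hq, h⟩ := hP
  exact ⟨algebraMap ℝ ℂ a * c, q, hq, by simp [h, mul_assoc]⟩

/-! ### Dictionary between filters, binary forms and polynomials -/

lemma filterPoly_eq_rename {k : ℕ} (w : Fin k → ℝ) :
    filterPoly w =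
      MvPolynomial.rename (Equiv.swap 0 1) ((ofFn k w).homogenize (k - 1)) := by
  -- The swap is needed because `homogenize` sends the polynomial variable to `X 0`, whereas here it
  -- is `y = X 1`.
  rw [ofFn_eq_sum_monomial, filterPoly, homogenize_finsetSum, map_sum]
  refine Finset.sum_congr rfl fun i _ => ?_
  rw [← C_mul_X_pow_eq_monomial, homogenize_C_mul, homogenize_X_pow (by omega)]
  simp only [map_mul, map_pow, MvPolynomial.rename_C, MvPolynomial.rename_X,
    Equiv.swap_apply_left, Equiv.swap_apply_right]
  ring

lemma map_filterPoly {k : ℕ} (w : Fin k → ℝ) :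
    MvPolynomial.map (algebraMap ℝ ℂ) (filterPoly w) =
      MvPolynomial.rename (Equiv.swap 0 1)
        (((ofFn k w).map (algebraMap ℝ ℂ)).homogenize (k - 1)) := by
  rw [filterPoly_eq_rename, MvPolynomial.map_rename, homogenize_map]

lemma natDegree_ofFn_le {k : ℕ} (w : Fin k → ℝ) : (ofFn k w).natDegree ≤ k - 1 := by
  rcases Nat.eq_zero_or_pos k with rfl | hk
  · simp
  · have := ofFn_natDegree_lt hk w
    omega

lemma aeval_map_filterPoly {k : ℕ} (w : Fin k → ℝ) :
    MvPolynomial.aeval ![1, X] (MvPolynomial.map (algebraMap ℝ ℂ) (filterPoly w)) =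
      (ofFn k w).map (algebraMap ℝ ℂ) := by
  rw [map_filterPoly, MvPolynomial.aeval_rename, aeval_homogenize_of_eq_one]
  · simp
  · rw [natDegree_map]
    exact natDegree_ofFn_le w
  · simp

lemma homogenize_pow_of_natDegree_le_one {q : ℂ[X]} (hq : q.natDegree ≤ 1) (n : ℕ) :
    (q ^ n).homogenize n = q.homogenize 1 ^ n := by
  induction n with
  | zero => simp
  | succ n ih =>
    rw [pow_succ, homogenize_mul _ _ (natDegree_pow_le_of_le n hq |>.trans (by simp)) hq, ih,
      pow_succ]

lemma natDegree_aeval_le_one {Q : MvPolynomial (Fin 2) ℂ} (hQ : Q.IsHomogeneous 1) :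
    (MvPolynomial.aeval ![1, (X : ℂ[X])] Q).natDegree ≤ 1 := by
  refine (MvPolynomial.aeval_natDegree_le Q hQ.totalDegree_le ![1, (X : ℂ[X])] (n := 1) ?_).trans
    le_rfl
  intro i
  fin_cases i <;> simp

/-- Because the parts sum to `N`, homogenizing the product in degree `N` homogenizes each linear
factor in degree one. -/
lemma filterPoly_mem_multipleRootLocus_iff {r N : ℕ} {Λ : Fin r → ℕ} (hΛ : ∑ i, Λ i = N)
    (w : Fin (N + 1) → ℝ) :
    filterPoly w ∈ multipleRootLocus Λ ↔ InRootLocus Λ (ofFn (N + 1) w) := by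
  constructor
  · rintro ⟨c, Q, hQ, h⟩
    refine ⟨c, fun i => MvPolynomial.aeval ![1, X] (Q i), fun i => natDegree_aeval_le_one (hQ i),
      ?_⟩
    rw [← aeval_map_filterPoly, h]
    simp
  · rintro ⟨c, q, hq, h⟩
    refine ⟨c, fun i => MvPolynomial.rename (Equiv.swap 0 1) ((q i).homogenize 1),
      fun i => (isHomogeneous_homogenize _).rename_isHomogeneous, ?_⟩
    rw [map_filterPoly, h, homogenize_C_mul, Nat.add_sub_cancel, ← hΛ, homogenize_finsetProd]
    · simp only [homogenize_pow_of_natDegree_le_one (hq _), map_mul, map_prod, map_pow,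
        MvPolynomial.rename_C]
    · intro i _
      exact (natDegree_pow_le_of_le _ (hq i)).trans (by simp)

lemma hasRepeatedRoot_of_sq_dvd {k : ℕ} (w : Fin k → ℝ) {z : ℂ}
    (h : (X - C z) ^ 2 ∣ (ofFn k w).map (algebraMap ℝ ℂ)) : HasRepeatedRoot (filterPoly w) := by
  by_cases h0 : (ofFn k w).map (algebraMap ℝ ℂ) = 0
  · refine ⟨1, 0, by simp, ?_⟩
    rw [map_filterPoly, h0]
    simp
  obtain ⟨s, hs⟩ := h
  refine ⟨1, z, by simp, ?_⟩
  have hs0 : s ≠ 0 := by rintro rfl; simp [hs] at h0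
  have hdeg : 2 + s.natDegree ≤ k - 1 := by
    have := natDegree_ofFn_le w
    rwa [← natDegree_map (algebraMap ℝ ℂ), hs,
      natDegree_mul (pow_ne_zero _ (X_sub_C_ne_zero z)) hs0, natDegree_pow, natDegree_X_sub_C]
      at this
  obtain ⟨e, he⟩ := Nat.exists_eq_add_of_le hdeg
  rw [map_filterPoly, hs, he, add_assoc, homogenize_mul _ _ (by simp) (by omega),
    homogenize_pow_of_natDegree_le_one (by simp), map_mul, map_pow]
  -- The factor `X - z` homogenizes to `y - z x`, minus the form attached to `[1 : z]`; squaring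
  -- removes the sign.
  have hlin : MvPolynomial.rename (Equiv.swap (0 : Fin 2) 1) ((X - C z : ℂ[X]).homogenize 1) =
      -(MvPolynomial.C z * MvPolynomial.X 0 - MvPolynomial.C 1 * MvPolynomial.X 1) := by
    rw [sub_eq_add_neg, ← C_neg, homogenize_add, homogenize_X one_ne_zero, homogenize_C]
    simp [sub_eq_add_neg]
  rw [hlin, neg_sq]
  exact dvd_mul_right _ _

/-- A degree drop of at least two means that `x ^ 2` divides the form, since `1` homogenizes to `x ^
2` in degree two. -/
lemma hasRepeatedRoot_of_natDegree_add_lt {k : ℕ} (w : Fin k → ℝ)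
    (h : (ofFn k w).natDegree + 1 < k - 1) : HasRepeatedRoot (filterPoly w) := by
  refine ⟨0, 1, by simp, ?_⟩
  obtain ⟨e, he⟩ := Nat.exists_eq_add_of_lt h
  rw [map_filterPoly, ← one_mul ((ofFn k w).map _),
    show k - 1 = 2 + ((ofFn k w).natDegree + e) by omega,
    homogenize_mul _ _ (by simp) (by simp), homogenize_one, map_mul, map_pow]
  simp

/-- The dehomogenization of a form without repeated roots is squarefree and drops degree by at
most one. -/
lemma squarefree_ofFn_of_not_hasRepeatedRoot {k : ℕ} {w : Fin k → ℝ}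
    (h : ¬ HasRepeatedRoot (filterPoly w)) :
    Squarefree (ofFn k w) ∧ k - 1 ≤ (ofFn k w).natDegree + 1 := by
  refine ⟨?_, not_lt.1 fun hlt => h (hasRepeatedRoot_of_natDegree_add_lt w hlt)⟩
  rw [squarefree_iff_irreducible_sq_not_dvd_of_ne_zero]
  · intro f hf hdvd
    obtain ⟨z, hz⟩ := IsAlgClosed.exists_root (f.map (algebraMap ℝ ℂ)) (by
      rw [degree_map]
      exact (degree_pos_of_irreducible hf).ne')
    refine h (hasRepeatedRoot_of_sq_dvd w (z := z) ?_)
    refine dvd_trans ?_ (Polynomial.map_dvd (algebraMap ℝ ℂ) hdvd)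
    rw [Polynomial.map_mul, sq]
    exact mul_dvd_mul (dvd_iff_isRoot.2 hz) (dvd_iff_isRoot.2 hz)
  · intro h0
    exact h (hasRepeatedRoot_of_sq_dvd w (z := 0) (by simp [h0]))

/-! ### Pencils and the directions they span -/

lemma pencil_pow_succ_mul (f u g : ℝ[X]) (m : ℕ) (t : ℝ) :
    (f + C t * u) ^ (m + 1) * g =
      (f + C t * u) ^ m * (f * g) + C t * ((f + C t * u) ^ m * (u * g)) := by
  ring

lemma contDiff_coeff_pencil (f u : ℝ[X]) (m : ℕ) (g : ℝ[X]) (i : ℕ) :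
    ContDiff ℝ ∞ fun t : ℝ => ((f + C t * u) ^ m * g).coeff i := by
  induction m generalizing g with
  | zero => simpa using contDiff_const
  | succ m ih =>
    simp only [pencil_pow_succ_mul, coeff_add, coeff_C_mul]
    exact (ih _).add (contDiff_id.mul (ih _))

lemma hasDerivAt_coeff_pencil (f u : ℝ[X]) (m : ℕ) (g : ℝ[X]) (i : ℕ) :
    HasDerivAt (fun t : ℝ => ((f + C t * u) ^ m * g).coeff i)
      (m * (u * f ^ (m - 1) * g).coeff i) 0 := by
  induction m generalizing g with
  | zero => simpa using hasDerivAt_const (0 : ℝ) (g.coeff i)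
  | succ m ih =>
    simp only [pencil_pow_succ_mul, coeff_add, coeff_C_mul]
    refine ((ih (f * g)).add ((hasDerivAt_id 0).mul (ih (u * g)))).congr_deriv ?_
    have h2 : f ^ m * (u * g) = u * f ^ m * g := by ring
    rcases m with _ | m
    · simp
    · have h1 : u * f ^ m * (f * g) = u * f ^ (m + 1) * g := by ring
      simp [h1, h2]
      ring

/-- Partial fractions: reduce the Bézout coefficient of `A` modulo `B`; the degree of the other one
is then forced. The bounds are weak so that `u` may have the full degree of `A * B`. -/
lemma exists_mul_add_mul_eq_of_isCoprime {K : Type*} [Field K] {A B u : K[X]}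
    (hAB : IsCoprime A B) (hB : B ≠ 0) (hu : u.natDegree ≤ A.natDegree + B.natDegree) :
    ∃ v w : K[X], v.natDegree ≤ B.natDegree ∧ w.natDegree ≤ A.natDegree ∧
      u = v * A + w * B := by
  obtain ⟨s, t, hst⟩ := hAB
  have hr : (u * s % B).natDegree ≤ B.natDegree :=
    natDegree_le_natDegree (degree_mod_lt _ hB).le
  have hdm := EuclideanDomain.div_add_mod (u * s) B
  have hu' : u = (u * s % B) * A + (u * t + (u * s / B) * A) * B := by
    linear_combination (-u) * hst - A * hdm
  refine ⟨u * s % B, u * t + (u * s / B) * A, hr, ?_, hu'⟩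
  by_cases h0 : u * t + (u * s / B) * A = 0
  · simp [h0]
  have hd : ((u * t + (u * s / B) * A) * B).natDegree ≤ A.natDegree + B.natDegree := by
    rw [← sub_eq_of_eq_add' hu']
    refine (natDegree_sub_le _ _).trans (max_le hu (natDegree_mul_le.trans ?_))
    omega
  rw [natDegree_mul h0 hB] at hd
  omega

section Tangent

variable {r : ℕ} {Λ : Fin r → ℕ} {P : ℝ[X]} {D : ℝ[X] →ₗ[ℝ] ℝ}

/-- The functional `D` vanishes on the velocities at `P` of the pencils `(f + t u) ^ (m + 1) * g`
that stay in the root locus. -/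
def VanishesOnPencils {r : ℕ} (Λ : Fin r → ℕ) (P : ℝ[X]) (D : ℝ[X] →ₗ[ℝ] ℝ) : Prop :=
  ∀ (m : ℕ) (f u g : ℝ[X]), f ^ (m + 1) * g = P →
    (∀ t : ℝ, ((f + C t * u) ^ (m + 1) * g).natDegree ≤ ∑ i, Λ i) →
    (∀ t : ℝ, InRootLocus Λ ((f + C t * u) ^ (m + 1) * g)) → D (u * f ^ m * g) = 0

lemma natDegree_pencil_le (f u g : ℝ[X]) (m : ℕ) (t : ℝ) {e : ℕ} (hf : f.natDegree ≤ e)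
    (hu : u.natDegree ≤ e) :
    ((f + C t * u) ^ m * g).natDegree ≤ m * e + g.natDegree := by
  refine natDegree_mul_le.trans (Nat.add_le_add_right (natDegree_pow_le_of_le m ?_) _)
  exact (natDegree_add_le _ _).trans (max_le hf ((natDegree_C_mul_le t u).trans hu))

variable (hP0 : P ≠ 0) (hdeg : P.natDegree ≤ ∑ i, Λ i) (hP : InRootLocus Λ P)
  (hD : VanishesOnPencils Λ P D)

include hdeg hP hD in
-- The locus is a cone, so it contains the line through `P`.
lemma VanishesOnPencils.scale (a : ℝ) : D (C a * P) = 0 := by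
  have h (t : ℝ) : (1 + C t * C a) ^ (0 + 1) * P = C (1 + t * a) * P := by simp
  have := hD 0 1 (C a) P (by simp)
    (fun t => by rw [h]; exact (natDegree_C_mul_le _ _).trans hdeg)
    (fun t => by rw [h]; exact hP.C_mul _)
  simpa using this

include hP0 hP hD in
lemma VanishesOnPencils.infinity (hlt : P.natDegree < ∑ i, Λ i) {u : ℝ[X]}
    (hu : u.natDegree ≤ 1) : D (u * P) = 0 := by
  obtain ⟨m, hm⟩ := Nat.exists_eq_add_of_lt hlt
  -- The pencil has `f = 1`, and its exponent `m + 1` is the degree deficit of `P`.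
  have := hD m 1 u P (by simp)
    (fun t => (natDegree_pencil_le 1 u P (m + 1) t (by simp) hu).trans (by omega))
    (fun t => hP.perturb_infinity hP0 (by omega) ((natDegree_C_mul_le t u).trans hu))
  simpa using this

include hP0 hdeg hP hD in
lemma VanishesOnPencils.irreducible {f H u : ℝ[X]} (hf : Irreducible f) (hfH : f * H = P)
    (hu : u.natDegree ≤ f.natDegree) : D (u * H) = 0 := by
  obtain ⟨g, hg, hfg⟩ :=
    (FiniteMultiplicity.of_prime_left hf.prime hP0).exists_eq_pow_mul_and_not_dvd
  have hm0 : multiplicity f P ≠ 0 := by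
    intro h0
    rw [h0, pow_zero, one_mul] at hg
    exact hfg (hg ▸ Dvd.intro H hfH)
  obtain ⟨m, hm⟩ := Nat.exists_eq_succ_of_ne_zero hm0
  rw [hm, Nat.succ_eq_add_one] at hg
  have hH : H = f ^ m * g := by
    refine mul_left_cancel₀ hf.ne_zero ?_
    rw [hfH, hg]
    ring
  have hg0 : g ≠ 0 := fun h0 => hfg (h0 ▸ dvd_zero f)
  have hPd : P.natDegree = (m + 1) * f.natDegree + g.natDegree := by
    rw [hg, natDegree_mul (pow_ne_zero _ hf.ne_zero) hg0, natDegree_pow]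
  have := hD m f u g hg.symm
    (fun t => (natDegree_pencil_le f u g (m + 1) t le_rfl hu).trans (hPd ▸ hdeg))
    (fun t => InRootLocus.perturb_irreducible hf hfg (hg ▸ hP)
      ((natDegree_C_mul_le t u).trans hu))
  rwa [mul_assoc, ← hH] at this

include hP0 hdeg hP hD in
-- Induction on the degree of `F`: split off an irreducible factor `f`, coprime to its cofactor `B`
-- by squarefreeness, and decompose `u` by partial fractions. Constant `F` reduces to scaling.
lemma VanishesOnPencils.squarefree {F H u : ℝ[X]} (hF : Squarefree F) (hFH : F * H = P)
    (hu : u.natDegree ≤ F.natDegree) : D (u * H) = 0 := by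
  have hF0 : F ≠ 0 := by rintro rfl; exact hP0 (by simpa using hFH.symm)
  induction hn : F.natDegree using Nat.strong_induction_on generalizing F H u with
  | _ n ih =>
    by_cases hunit : IsUnit F
    · obtain ⟨c, hc, rfl⟩ := isUnit_iff.1 hunit
      rw [natDegree_C] at hu
      obtain ⟨a, rfl⟩ := natDegree_eq_zero.1 (Nat.le_zero.1 hu)
      have h := VanishesOnPencils.scale hdeg hP hD (a / c)
      rwa [← hFH, ← mul_assoc, ← C_mul, div_mul_cancel₀ _ hc.ne_zero] at h
    · obtain ⟨f, hf, B, rfl⟩ := WfDvdMonoid.exists_irreducible_factor hunit hF0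
      have hB0 : B ≠ 0 := right_ne_zero_of_mul hF0
      have hcop : IsCoprime f B := by
        refine (dvd_or_isCoprime f B hf).resolve_left fun hdvd => hf.not_isUnit (hF f ?_)
        exact mul_dvd_mul_left f hdvd
      have hdf := natDegree_mul hf.ne_zero hB0
      obtain ⟨v, w, hv, hw, rfl⟩ := exists_mul_add_mul_eq_of_isCoprime hcop hB0 (hdf ▸ hu)
      have hpos : 0 < f.natDegree := hf.natDegree_pos
      have h1 := ih B.natDegree (by omega) (H := f * H) (u := v) (hF.of_mul_right)
        (by rw [← hFH]; ring) hv hB0 rfl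
      have h2 := VanishesOnPencils.irreducible hP0 hdeg hP hD hf (H := B * H)
        (by rw [← hFH]; ring) hw
      rw [show (v * f + w * B) * H = v * (f * H) + w * (B * H) by ring, map_add, h1, h2, add_zero]

include hP0 hdeg hP hD in
-- Here `n` is the degree of the form and `F` its dehomogenization. If `n` exceeds the degree of `F`
-- by one, infinity is a simple root. Dividing `u` by `F`, the quotient, of degree at most one,
-- moves the root at infinity, and the remainder moves the finite roots.
lemma VanishesOnPencils.squarefree_form {n : ℕ} {F H u : ℝ[X]} (hF : Squarefree F)
    (hFH : F * H = P) (hn : n ≤ F.natDegree + 1) (hH : H.natDegree + n ≤ ∑ i, Λ i)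
    (hu : u.natDegree ≤ n) : D (u * H) = 0 := by
  rcases hn.lt_or_eq with hn | rfl
  · exact VanishesOnPencils.squarefree hP0 hdeg hP hD hF hFH (hu.trans (Nat.lt_succ_iff.1 hn))
  have hF0 : F ≠ 0 := by rintro rfl; exact hP0 (by simpa using hFH.symm)
  have hH0 : H ≠ 0 := by rintro rfl; exact hP0 (by simpa using hFH.symm)
  have h1 : D (u % F * H) = 0 :=
    VanishesOnPencils.squarefree hP0 hdeg hP hD hF hFH
      (natDegree_le_natDegree (degree_mod_lt _ hF0).le)
  have h2 : D (u / F * P) = 0 := by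
    refine VanishesOnPencils.infinity hP0 hP hD ?_ ?_
    · rw [← hFH, natDegree_mul hF0 hH0]
      omega
    · by_cases hq : u / F = 0
      · simp [hq]
      have hd : (F * (u / F)).natDegree ≤ F.natDegree + 1 := by
        rw [eq_sub_of_add_eq (EuclideanDomain.div_add_mod u F)]
        exact (natDegree_sub_le _ _).trans (max_le hu
          ((natDegree_le_natDegree (degree_mod_lt _ hF0).le).trans (Nat.le_succ _)))
      rw [natDegree_mul hF0 hq] at hd
      omega
  rw [← EuclideanDomain.div_add_mod u F,
    show (F * (u / F) + u % F) * H = u / F * P + u % F * H by rw [← hFH]; ring, map_add, h1, h2,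
    add_zero]

end Tangent

/-! ### Toeplitz matrices and the network map -/

/-- The upper triangular Toeplitz matrix with the coefficients of `p` on its diagonals. -/
noncomputable def toeplitz (m n : ℕ) : ℝ[X] →ₗ[ℝ] Matrix (Fin m) (Fin n) ℝ where
  toFun p := Matrix.of fun i c => if (i : ℕ) ≤ c then p.coeff (c - i) else 0
  map_add' p q := by
    ext i c
    simp only [Matrix.of_apply, Matrix.add_apply, coeff_add]
    split_ifs <;> simp
  map_smul' a p := by
    ext i c
    simp [Matrix.of_apply, Matrix.smul_apply]

lemma toeplitz_apply {m n : ℕ} (p : ℝ[X]) (i : Fin m) (c : Fin n) :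
    toeplitz m n p i c = if (i : ℕ) ≤ c then p.coeff (c - i) else 0 :=
  rfl

lemma toeplitz_one (n : ℕ) : toeplitz n n 1 = 1 := by
  ext i c
  rw [toeplitz_apply, Matrix.one_apply, coeff_one]
  simp only [Fin.ext_iff]
  split_ifs <;> first | rfl | omega

lemma convMatrix_eq_toeplitz {k : ℕ} (m n : ℕ) (w : Fin k → ℝ) :
    convMatrix m n w = toeplitz m n (ofFn k w) := by
  ext i c
  rw [toeplitz_apply, convMatrix, Matrix.of_apply]
  split_ifs with hic
  · by_cases hk : (c : ℕ) - i < k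
    · rw [ofFn_coeff_eq_val_of_lt w hk, Finset.sum_eq_single ⟨(c : ℕ) - i, hk⟩]
      · rw [if_pos (by simp only; omega)]
      · intro j _ hj
        rw [if_neg]
        intro h
        exact hj (Fin.ext (by simp only; omega))
      · simp
    · rw [ofFn_coeff_eq_zero_of_ge w (not_lt.1 hk)]
      exact Finset.sum_eq_zero fun j _ => if_neg (by omega)
  · exact Finset.sum_eq_zero fun j _ => if_neg (by omega)

/-- By additivity `q` may be a monomial of degree `j`, whose matrix has only the entry in column `i
+ j` in row `i`. The hypothesis `hq` keeps `i + j` below `b`, so nothing is truncated. -/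
lemma toeplitz_mul {a b c : ℕ} (q p : ℝ[X]) (hq : q.natDegree + a ≤ b) :
    toeplitz a b q * toeplitz b c p = toeplitz a c (q * p) := by
  rcases Nat.eq_zero_or_pos a with rfl | ha
  · ext i
    exact i.elim0
  refine induction_with_natDegree_le
    (fun q => toeplitz a b q * toeplitz b c p = toeplitz a c (q * p)) (b - a) (by simp) ?_ ?_ q
    (by omega)
  · intro j r _ hj
    ext i e
    have hij : (i : ℕ) + j < b := by omega
    rw [Matrix.mul_apply, Finset.sum_eq_single ⟨i + j, hij⟩]
    · simp only [toeplitz_apply, mul_assoc, coeff_C_mul, coeff_X_pow, coeff_X_pow_mul',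
        Nat.le_add_right, Nat.add_sub_cancel_left, if_true, mul_one]
      by_cases h : (i : ℕ) + j ≤ e
      · rw [if_pos h, if_pos (by omega), if_pos (by omega), Nat.sub_add_eq]
      · rw [if_neg h]
        split_ifs <;> first | omega | simp
    · intro x _ hx
      rw [toeplitz_apply, coeff_C_mul, coeff_X_pow]
      have : (x : ℕ) ≠ i + j := fun h => hx (Fin.ext h)
      split_ifs <;> first | omega | simp
    · simp
  · intro f g _ _ hf hg
    rw [map_add, Matrix.add_mul, hf, hg, add_mul, map_add]

/-- The first row lists all the coefficients, so one row suffices. -/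
lemma toeplitz_injOn {m n : ℕ} (hm : 0 < m) {p q : ℝ[X]} (hp : p.natDegree < n)
    (hq : q.natDegree < n) (h : toeplitz m n p = toeplitz m n q) : p = q := by
  ext j
  by_cases hj : j < n
  · simpa [toeplitz_apply] using congrFun (congrFun h ⟨0, hm⟩) ⟨j, hj⟩
  · rw [coeff_eq_zero_of_natDegree_lt (by omega), coeff_eq_zero_of_natDegree_lt (by omega)]

lemma filter_castSucc_lt_succ {L : ℕ} (i : Fin L) :
    Finset.univ.filter (fun l : Fin L => l.castSucc < i.succ) =
      insert i (Finset.univ.filter fun l : Fin L => l.castSucc < i.castSucc) := by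
  ext l
  simp only [Finset.mem_filter, Finset.mem_univ, true_and, Finset.mem_insert, Fin.lt_def,
    Fin.ext_iff, Fin.val_castSucc, Fin.val_succ]
  omega

lemma filter_castSucc_lt_last (L : ℕ) :
    Finset.univ.filter (fun l : Fin L => l.castSucc < Fin.last L) = Finset.univ := by
  simp [Fin.castSucc_lt_last]

section Network

variable {L : ℕ} {d : Fin (L + 1) → ℕ} {k : Fin L → ℕ}

lemma paramMap_eq_toeplitz (hk : ∀ l, 1 ≤ k l)
    (hd : ∀ l : Fin L, d l.succ + k l = d l.castSucc + 1) (θ : ∀ l : Fin L, Fin (k l) → ℝ) :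
    paramMap d k θ = toeplitz (d (Fin.last L)) (d 0) (∏ l, ofFn (k l) (θ l)) := by
  have key (i : Fin (L + 1)) :
      Fin.induction (motive := fun l => Matrix (Fin (d l)) (Fin (d 0)) ℝ) 1
        (fun l M => convMatrix (d l.succ) (d l.castSucc) (θ l) * M) i =
      toeplitz (d i) (d 0) (∏ l with l.castSucc < i, ofFn (k l) (θ l)) := by
    induction i using Fin.induction with
    | zero => simp [toeplitz_one]
    | succ i ih =>
      rw [Fin.induction_succ, ih, convMatrix_eq_toeplitz, toeplitz_mul, filter_castSucc_lt_succ,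
        Finset.prod_insert (by simp)]
      have := natDegree_ofFn_le (θ i)
      have := hd i
      have := hk i
      omega
  have h := key (Fin.last L)
  rwa [filter_castSucc_lt_last] at h

lemma inputDim_eq (hk : ∀ l, 1 ≤ k l)
    (hd : ∀ l : Fin L, d l.succ + k l = d l.castSucc + 1) :
    d 0 = d (Fin.last L) + ∑ l, (k l - 1) := by
  have key (i : Fin (L + 1)) : d 0 = d i + ∑ l with l.castSucc < i, (k l - 1) := by
    induction i using Fin.induction with
    | zero => simp
    | succ i ih =>
      rw [filter_castSucc_lt_succ, Finset.sum_insert (by simp)]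
      have := hd i
      have := hk i
      omega
  have h := key (Fin.last L)
  rwa [filter_castSucc_lt_last] at h

lemma contDiff_coeff_prod_ofFn (s : Finset (Fin L)) (j : ℕ) :
    ContDiff ℝ ∞ fun η : ∀ l : Fin L, Fin (k l) → ℝ => (∏ l ∈ s, ofFn (k l) (η l)).coeff j := by
  induction s using Finset.induction_on generalizing j with
  | empty => simpa using contDiff_const
  | insert a s ha ih =>
    simp only [Finset.prod_insert ha, coeff_mul]
    refine ContDiff.sum fun x _ => ContDiff.mul ?_ (ih _)
    exact (LinearMap.toContinuousLinearMap
      ((lcoeff ℝ x.1).comp ((ofFn (k a)).comp (LinearMap.proj (R := ℝ) (φ := fun l => Fin (k l) → ℝ) a)))).contDiff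

end Network

/-! ### Criticality on the locus and the chain rule -/

lemma toFn_apply {n : ℕ} (p : ℝ[X]) (i : Fin n) : toFn n p i = p.coeff i := rfl

/-- The differential at a critical point of the restriction to the multiple root locus vanishes on
the velocities of pencils in the locus. -/
lemma IsCriticalOn.vanishesOnPencils {r N : ℕ} {Λ : Fin r → ℕ} (hΛ : ∑ i, Λ i = N)
    {φ : (Fin (N + 1) → ℝ) → ℝ} {w : Fin (N + 1) → ℝ}
    (hw : IsCriticalOn φ (filterPoly ⁻¹' multipleRootLocus Λ) w) :
    VanishesOnPencils Λ (ofFn (N + 1) w)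
      ((fderiv ℝ φ w : (Fin (N + 1) → ℝ) →ₗ[ℝ] ℝ) ∘ₗ toFn (N + 1)) := by
  intro m f u g hP hdeg hloc
  -- The pencil's velocity carries the factor `m + 1`, which is nonzero and is cancelled at the end.
  have hv := hw.2 (toFn (N + 1) (((m + 1 : ℕ) : ℝ) • (u * f ^ m * g))) <| by
    refine ⟨fun t => toFn (N + 1) ((f + C t * u) ^ (m + 1) * g), ?_, ?_, ?_, ?_⟩
    · exact contDiffAt_pi.2 fun i => (contDiff_coeff_pencil f u (m + 1) g i).contDiffAt
    · simp only [C_0, zero_mul, add_zero, hP]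
      exact toFn_comp_ofFn_eq_id _ _
    · refine Filter.Eventually.of_forall fun t => ?_
      rw [Set.mem_preimage, filterPoly_mem_multipleRootLocus_iff hΛ,
        ofFn_comp_toFn_eq_id_of_natDegree_lt (Nat.lt_succ_of_le (hΛ ▸ hdeg t))]
      exact hloc t
    · refine hasDerivAt_pi.2 fun i => ?_
      exact (hasDerivAt_coeff_pencil f u (m + 1) g i).congr_deriv (by
        simp [toFn_apply])
  rw [map_smul, map_smul, smul_eq_zero] at hv
  exact hv.resolve_left (by positivity)

/-- A filter tuple without repeated roots lying over a critical point of the restricted loss is a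
critical point of the loss pulled back along the parameterization map. -/
theorem hasFDerivAt_zero_of_isCriticalOn {L N : ℕ} {d : Fin (L + 1) → ℕ} {k : Fin L → ℕ}
    (hk : ∀ l, 1 ≤ k l) (hd : ∀ l : Fin L, d l.succ + k l = d l.castSucc + 1)
    {ℓ : Matrix (Fin (d (Fin.last L))) (Fin (d 0)) ℝ → ℝ} (hℓ : ContDiff ℝ ∞ ℓ)
    {r : ℕ} {Λ : Fin r → ℕ} (hΛ_sum : ∑ i, Λ i = N) (hN : ∑ l, (k l - 1) = N)
    {w : Fin (N + 1) → ℝ}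
    (hw : IsCriticalOn (fun v : Fin (N + 1) → ℝ => ℓ (convMatrix (d (Fin.last L)) (d 0) v))
      (filterPoly ⁻¹' multipleRootLocus Λ) w)
    {θ : ∀ l : Fin L, Fin (k l) → ℝ}
    (hθ : paramMap d k θ = convMatrix (d (Fin.last L)) (d 0) w)
    (hroots : ∀ l, ¬ HasRepeatedRoot (filterPoly (θ l))) :
    HasFDerivAt (fun η : ∀ l : Fin L, Fin (k l) → ℝ => ℓ (paramMap d k η))
      (0 : (∀ l : Fin L, Fin (k l) → ℝ) →L[ℝ] ℝ) θ := by
  -- With no output rows the matrix does not determine the filter, but then the loss is constant.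
  rcases Nat.eq_zero_or_pos (d (Fin.last L)) with h0 | hpos
  · have : IsEmpty (Fin (d (Fin.last L))) := by rw [h0]; infer_instance
    have hconst (η : ∀ l : Fin L, Fin (k l) → ℝ) : paramMap d k η = paramMap d k θ :=
      Matrix.ext fun i => isEmptyElim i
    simp only [hconst]
    exact hasFDerivAt_const _ _
  set φ : (Fin (N + 1) → ℝ) → ℝ := fun v => ℓ (convMatrix (d (Fin.last L)) (d 0) v) with hφ
  have hdim : d 0 = d (Fin.last L) + N := hN ▸ inputDim_eq hk hd
  have hdegProd (η : ∀ l : Fin L, Fin (k l) → ℝ) (s : Finset (Fin L)) :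
      (∏ l ∈ s, ofFn (k l) (η l)).natDegree ≤ ∑ l ∈ s, (k l - 1) :=
    (natDegree_prod_le _ _).trans (Finset.sum_le_sum fun l _ => natDegree_ofFn_le (η l))
  have hdegw : (ofFn (N + 1) w).natDegree ≤ N := natDegree_ofFn_le w
  have hprod : ∏ l, ofFn (k l) (θ l) = ofFn (N + 1) w := by
    rw [paramMap_eq_toeplitz hk hd, convMatrix_eq_toeplitz] at hθ
    exact toeplitz_injOn hpos (by have := hdegProd θ Finset.univ; rw [hN] at this; omega) (by omega) hθ
  have hsq (l : Fin L) := squarefree_ofFn_of_not_hasRepeatedRoot (hroots l)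
  have hP0 : ofFn (N + 1) w ≠ 0 := by
    rw [← hprod]
    exact Finset.prod_ne_zero_iff.2 fun l _ => (hsq l).1.ne_zero
  have hP : InRootLocus Λ (ofFn (N + 1) w) :=
    (filterPoly_mem_multipleRootLocus_iff hΛ_sum w).1 hw.1.1
  have hD := hw.vanishesOnPencils hΛ_sum
  let Φ : (∀ l : Fin L, Fin (k l) → ℝ) → Fin (N + 1) → ℝ :=
    fun η => toFn (N + 1) (∏ l, ofFn (k l) (η l))
  have hΦθ : Φ θ = w := by
    simp only [Φ, hprod]
    exact toFn_comp_ofFn_eq_id _ _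
  have hfactor : (fun η : ∀ l : Fin L, Fin (k l) → ℝ => ℓ (paramMap d k η)) = φ ∘ Φ := by
    funext η
    simp only [hφ, Function.comp_apply, Φ]
    rw [paramMap_eq_toeplitz hk hd, convMatrix_eq_toeplitz,
      ofFn_comp_toFn_eq_id_of_natDegree_lt (Nat.lt_succ_of_le (hN ▸ hdegProd η Finset.univ))]
  have hΦ : DifferentiableAt ℝ Φ θ :=
    differentiableAt_pi.2 fun i =>
      (contDiff_coeff_prod_ofFn Finset.univ i).differentiable (by simp) θ
  have hφd : DifferentiableAt ℝ φ (Φ θ) := by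
    have hlin : φ = ℓ ∘ (toeplitz (d (Fin.last L)) (d 0) ∘ₗ ofFn (N + 1)).toContinuousLinearMap := by
      funext v
      simp [hφ, convMatrix_eq_toeplitz]
    rw [hlin]
    exact ((hℓ.differentiable (by simp)).comp (ContinuousLinearMap.differentiable _)) _
  rw [hfactor]
  refine (hφd.hasFDerivAt.comp θ hΦ.hasFDerivAt).congr_fderiv ?_
  -- By linearity it suffices to vary one layer at a time.
  refine ContinuousLinearMap.coe_injective (LinearMap.pi_ext fun l x => ?_)
  set e : ∀ l : Fin L, Fin (k l) → ℝ := Pi.single l x with he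
  set H := ∏ j ∈ Finset.univ.erase l, ofFn (k j) (θ j) with hH
  have hFH : ofFn (k l) (θ l) * H = ofFn (N + 1) w := by
    rw [hH, Finset.mul_prod_erase _ (fun j => ofFn (k j) (θ j)) (Finset.mem_univ l), hprod]
  -- The product is multilinear in the filters, so `Φ` is affine along `e`, and its slope is the
  -- derivative in that direction.
  have hline (t : ℝ) : Φ (θ + t • e) =
      w + t • toFn (N + 1) (ofFn (k l) x * H) := by
    simp only [Φ]
    rw [← Finset.mul_prod_erase _ _ (Finset.mem_univ l), ← hΦθ]
    simp only [Φ]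
    rw [← map_smul, ← map_add, hprod, ← hFH]
    congr 1
    have hrest : ∏ j ∈ Finset.univ.erase l, ofFn (k j) ((θ + t • e) j) = H :=
      Finset.prod_congr rfl fun j hj => by
        simp [he, Pi.single_eq_of_ne (Finset.ne_of_mem_erase hj)]
    rw [hrest]
    simp [he, add_mul]
  have hdir : fderiv ℝ Φ θ (e) = toFn (N + 1) (ofFn (k l) x * H) := by
    have h1 : HasLineDerivAt ℝ Φ (fderiv ℝ Φ θ (e)) θ (e) :=
      hΦ.hasFDerivAt.hasLineDerivAt _
    refine h1.unique ?_
    simp only [HasLineDerivAt, hline]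
    simpa using ((hasDerivAt_id (0 : ℝ)).smul_const (toFn (N + 1) (ofFn (k l) x * H))).const_add w
  have hHdeg : H.natDegree + (k l - 1) ≤ ∑ i, Λ i := by
    rw [hΛ_sum, ← hN, ← Finset.sum_erase_add _ _ (Finset.mem_univ l)]
    exact Nat.add_le_add_right (hdegProd θ _) _
  have hzero := VanishesOnPencils.squarefree_form hP0 (hΛ_sum ▸ hdegw) hP hD (hsq l).1 hFH
    (hsq l).2 hHdeg (natDegree_ofFn_le x)
  change fderiv ℝ φ (Φ θ) (fderiv ℝ Φ θ e) = 0
  rw [hdir, hΦθ]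
  exact hzero

end LCN

theorem mainTheorem3 {L : ℕ} (d : Fin (L + 1) → ℕ) (k : Fin L → ℕ)
    (hk : ∀ l, 1 ≤ k l)
    (hd : ∀ l : Fin L, d l.succ + k l = d l.castSucc + 1)
    (ℓ : Matrix (Fin (d (Fin.last L))) (Fin (d 0)) ℝ → ℝ) (hℓ : ContDiff ℝ ∞ ℓ)
    {r : ℕ} (Λ : Fin r → ℕ) (hΛ_pos : ∀ i, 0 < Λ i) (hΛ_sum : ∑ i, Λ i = ∑ l, (k l - 1))
    (w : Fin (∑ l, (k l - 1) + 1) → ℝ)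
    (hw : LCN.IsCriticalOn
      (fun v : Fin (∑ l, (k l - 1) + 1) → ℝ => ℓ (LCN.convMatrix (d (Fin.last L)) (d 0) v))
      (LCN.filterPoly ⁻¹' LCN.multipleRootLocus Λ) w)
    (θ : ∀ l : Fin L, Fin (k l) → ℝ)
    (hθ : LCN.paramMap d k θ = LCN.convMatrix (d (Fin.last L)) (d 0) w)
    (hroots : ∀ l, ¬ LCN.HasRepeatedRoot (LCN.filterPoly (θ l))) :
    HasFDerivAt (fun η : ∀ l : Fin L, Fin (k l) → ℝ => ℓ (LCN.paramMap d k η))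
      (0 : (∀ l : Fin L, Fin (k l) → ℝ) →L[ℝ] ℝ) θ := by
  exact LCN.hasFDerivAt_zero_of_isCriticalOn hk hd hℓ hΛ_sum rfl hw hθ hroots
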